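/- Let $\mathcal{K}$ be a tensor triangulated category: an (essentially small) triangulated category $(\mathcal{K},\Sigma)$ with a symmetric monoidal structure $(\otimes,\mathbb{1})$ and natural isomorphisms $\Sigma a\otimes b\simeq\Sigma(a\otimes b)$ and $a\otimes\Sigma b\simeq\Sigma(a\otimes b)$, such that $a\otimes-$ and $-\otimes a$ are exact functors for every object $a$, the suspension isomorphisms are compatible with the symmetry, associator and unitors, and the two induced isomorphisms $\Sigma a\otimes\Sigma b\simeq\Sigma^2(a\otimes b)$ differ by the sign $-1$. The spectrum $\operatorname{Spc}(\mathcal{K})$ is the set of prime ideals of $\mathcal K$, i.e. of proper thick $\otimes$-ideals $\mathcal{P}$ such that $a\otimes b\in\mathcal{P}$ implies $a\in\mathcal{P}$ or $b\in\mathcal{P}$, with the topology having the supports $\operatorname{supp}(a)=\{\mathcal{P} : a\notin\mathcal{P}\}$ as a basis of closed sets. A subset of $\operatorname{Spc}(\mathcal{K})$ is Thomason if it is a union of closed subsets each of which has quasi-compact complement. Call $\mathcal{K}$ rigid if every object is dualizable and the functor $D:\mathcal{K}^{\mathrm{op}}\to\mathcal{K}$ taking duals is exact. Let $\Phi$ be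 a non-empty set of objects of $\mathcal{K}$ closed under $\otimes$, and put $\mathcal{Z}_\Phi:=\bigcap_{X\in\Phi}\operatorname{supp}(X)\subset\operatorname{Spc}(\mathcal{K})$. For an object $X$ let $E_X:=\{f\in\operatorname{End}(X) : f\otimes X=X\otimes f \text{ in } \operatorname{End}(X\otimes X)\}$. Let $R_\Phi$ be the set of pairs $(X,f)$ with $X\in\Phi$ and $f\in E_X$, modulo the smallest equivalence relation such that $(X,f)\sim(a\otimes X,a\otimes f)$ and $(X,f)\sim(X\otimes a,f\otimes a)$ for all $a\in\Phi$; it is a commutative ring with $[f_X]+[g_Y]=[f\otimes Y+X\otimes g]$ and $[f_X]\cdot[g_Y]=[(f\otimes Y)\circ(X\otimes g)]$. Proposition. Suppose that $\mathcal{K}$ is rigid and that $\mathcal{Z}_\Phi$ is Thomason. If $\operatorname{Spec}(R_\Phi)$ is connected, then $\mathcal{Z}_\Phi$ is connected. (This holds both when "connected" means "not a disjoint union of two non-empty closed subsets", so that the empty space is connected, and when connected spaces are moreover required to be non-empty.) -/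

import Mathlib

open CategoryTheory MonoidalCategory Limits Pretriangulated

universe v u

noncomputable section

namespace TTGeom

/-! ### Tensor triangulated categories -/

section TensorTriangulated

open scoped CategoryTheory.Pretriangulated.Opposite

variable (C : Type u) [Category.{v} C] [HasZeroObject C] [HasShift C ℤ] [Preadditive C]
  [∀ n : ℤ, (shiftFunctor C n).Additive] [Pretriangulated C]
  [MonoidalCategory C]

/-- Compatibility of a symmetric monoidal structure with a triangulation.
The instance `(curriedTensor C).CommShift₂Int` provides the natural suspension isomorphisms
`a ⊗ Σ b ≅ Σ (a ⊗ b)` and `Σ a ⊗ b ≅ Σ (a ⊗ b)`, together with the requirement that the two ways of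
identifying `Σ a ⊗ Σ b` with `Σ (Σ (a ⊗ b))` differ by the sign `-1`.  The fields below say that
tensoring with an object, on either side, is an exact functor (with respect to these suspension
isomorphisms), and that the suspension isomorphisms are compatible with the symmetry, the
associator and the unitor. -/
class TensorTriangulated [SymmetricCategory C] [(curriedTensor C).CommShift₂Int] : Prop where
  exact_tensorLeft (a : C) : (tensorLeft a).IsTriangulated
  exact_tensorRight (a : C) : (tensorRight a).IsTriangulated
  braiding_suspension (a b : C) :
    (β_ (a⟦(1 : ℤ)⟧) b).hom ≫ ((tensorLeft b).commShiftIso (1 : ℤ)).hom.app a =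
      ((tensorRight b).commShiftIso (1 : ℤ)).hom.app a ≫ ((β_ a b).hom)⟦(1 : ℤ)⟧'
  associator_suspension (a b c : C) :
    (α_ (a⟦(1 : ℤ)⟧) b c).hom ≫ ((tensorRight (b ⊗ c)).commShiftIso (1 : ℤ)).hom.app a =
      ((tensorRight b).commShiftIso (1 : ℤ)).hom.app a ▷ c ≫
        ((tensorRight c).commShiftIso (1 : ℤ)).hom.app (a ⊗ b) ≫ ((α_ a b c).hom)⟦(1 : ℤ)⟧'
  unitor_suspension (a : C) :
    ((tensorRight (𝟙_ C)).commShiftIso (1 : ℤ)).hom.app a ≫ ((ρ_ a).hom)⟦(1 : ℤ)⟧' =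
      (ρ_ (a⟦(1 : ℤ)⟧)).hom

/-- The contravariant functor "taking duals", when every object has a dual. -/
def dualFunctor [RightRigidCategory C] : Cᵒᵖ ⥤ C where
  obj X := (X.unop)ᘁ
  map f := (f.unop)ᘁ
  map_id _ := rightAdjointMate_id
  map_comp _ _ := comp_rightAdjointMate

/-- Rigidity: every object is dualizable (in a symmetric monoidal category, right duals are two-sided
duals) and taking duals `Cᵒᵖ ⥤ C` is an exact functor, i.e. it commutes with suspension in such a way
that it preserves exact triangles. -/
def IsRigid : Prop :=
  ∃ (_ : RightRigidCategory C) (_ : (dualFunctor C).CommShift ℤ), (dualFunctor C).IsTriangulated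

end TensorTriangulated

/-! ### The spectrum -/

section Spectrum

variable (C : Type u) [Category.{v} C] [HasZeroObject C] [HasShift C ℤ] [Preadditive C]
  [∀ n : ℤ, (shiftFunctor C n).Additive] [Pretriangulated C]
  [MonoidalCategory C] [SymmetricCategory C]

/-- The points of the Balmer spectrum: prime ideals, i.e. proper thick tensor ideals `P` (full
triangulated subcategories, closed under isomorphisms, direct summands, and tensoring with arbitrary
objects) such that `a ⊗ b ∈ P` implies `a ∈ P` or `b ∈ P`. -/
@[ext]
structure Spc where
  /-- The objects belonging to the prime. -/
  mem : ObjectProperty C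
  isTriangulated : mem.IsTriangulated
  isClosedUnderIsomorphisms : mem.IsClosedUnderIsomorphisms
  isStableUnderRetracts : mem.IsStableUnderRetracts
  tensor_mem : ∀ a b : C, mem b → mem (a ⊗ b)
  proper : ∃ a : C, ¬ mem a
  prime : ∀ a b : C, mem (a ⊗ b) → mem a ∨ mem b

variable {C}

/-- The support of an object: the primes which do not contain it. -/
def supp (a : C) : Set (Spc C) := {P | ¬ P.mem a}

/-- The Balmer topology: the supports of the objects form a basis of closed subsets. -/
instance : TopologicalSpace (Spc C) :=
  TopologicalSpace.generateFrom (Set.range fun a : C => (supp a)ᶜ)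

end Spectrum

/-- A subset is Thomason if it is a union of closed subsets with quasi-compact complements. -/
def IsThomason {X : Type*} [TopologicalSpace X] (Y : Set X) : Prop :=
  ∃ S : Set (Set X), (∀ Z ∈ S, IsClosed Z ∧ IsCompact Zᶜ) ∧ Y = ⋃₀ S

/-! ### The ring attached to a tensor-multiplicative set of objects -/

section Ring

variable {C : Type u} [Category.{v} C] [MonoidalCategory C]

variable (C) in
/-- A non-empty set of objects which is closed under the tensor product. -/
structure TensorMultiplicativeSet where
  carrier : Set C
  nonempty : carrier.Nonempty
  tensor_mem : ∀ a ∈ carrier, ∀ b ∈ carrier, a ⊗ b ∈ carrier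

variable [Preadditive C] [MonoidalPreadditive C]

/-- The ring `E_X` of tensor-balanced endomorphisms of `X`: those `f` with `f ⊗ X = X ⊗ f`. -/
def balancedEnd (X : C) : Subring (End X) where
  carrier := {f | (f : X ⟶ X) ▷ X = X ◁ (f : X ⟶ X)}
  mul_mem' {f g} hf hg := by
    simp only [Set.mem_ofPred_eq, End.mul_def, comp_whiskerRight, MonoidalCategory.whiskerLeft_comp]
      at *
    rw [hf, hg]
  one_mem' := by simp [End.one_def]
  add_mem' {f g} hf hg := by
    simp only [Set.mem_ofPred_eq] at *
    change (f + g : X ⟶ X) ▷ X = X ◁ (f + g : X ⟶ X)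
    rw [MonoidalPreadditive.add_whiskerRight, MonoidalPreadditive.whiskerLeft_add, hf, hg]
  zero_mem' := by
    change (0 : X ⟶ X) ▷ X = X ◁ (0 : X ⟶ X)
    simp
  neg_mem' {f} hf := by
    simp only [Set.mem_ofPred_eq] at *
    change (-f : X ⟶ X) ▷ X = X ◁ (-f : X ⟶ X)
    have h1 := (tensorRight X).map_neg (f := (f : X ⟶ X))
    have h2 := (tensorLeft X).map_neg (f := (f : X ⟶ X))
    simp only [curriedTensor_obj_map, Functor.flip_obj_map, curriedTensor_map_app] at h1 h2
    rw [h1, h2, hf]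

lemma mem_balancedEnd {X : C} {f : End X} :
    f ∈ balancedEnd X ↔ (f : X ⟶ X) ▷ X = X ◁ (f : X ⟶ X) := Iff.rfl

/-- Conjugating a balanced endomorphism by an isomorphism gives a balanced endomorphism. -/
lemma conj_mem_balancedEnd {X Y : C} (e : X ≅ Y) {f : End X} (hf : f ∈ balancedEnd X)
    {g : End Y} (h : (f : X ⟶ X) ≫ e.hom = e.hom ≫ (g : Y ⟶ Y)) : g ∈ balancedEnd Y := by
  rw [mem_balancedEnd] at *
  have hg : (g : Y ⟶ Y) = e.inv ≫ f ≫ e.hom := by rw [h]; simp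
  rw [hg]
  have key : (e.inv ⊗ₘ e.inv) ≫ (f : X ⟶ X) ▷ X ≫ (e.hom ⊗ₘ e.hom) =
      (e.inv ⊗ₘ e.inv) ≫ X ◁ (f : X ⟶ X) ≫ (e.hom ⊗ₘ e.hom) := by rw [hf]
  rw [← tensorHom_id, ← id_tensorHom] at key ⊢
  simpa only [← id_tensorHom, ← tensorHom_id, tensorHom_comp_tensorHom, Category.id_comp,
    Category.comp_id, Iso.inv_hom_id] using key

variable [SymmetricCategory C]

lemma whiskerRight_mem_balancedEnd {X : C} {f : End X} (hf : f ∈ balancedEnd X) (Y : C) :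
    (show End (X ⊗ Y) from (f : X ⟶ X) ▷ Y) ∈ balancedEnd (X ⊗ Y) := by
  rw [mem_balancedEnd] at *
  have h1 := tensorμ_natural (f : X ⟶ X) (𝟙 Y) (𝟙 X) (𝟙 Y)
  have h2 := tensorμ_natural (𝟙 X) (𝟙 Y) (f : X ⟶ X) (𝟙 Y)
  simp only [tensorHom_id, id_tensorHom, id_whiskerRight] at h1 h2
  rw [hf, ← h2] at h1
  have hiso : tensorμ X Y X Y ≫ tensorδ X Y X Y = 𝟙 _ := tensorμ_tensorδ X Y X Y
  have := congrArg (fun k => k ≫ tensorδ X Y X Y) h1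
  simpa only [Category.assoc, hiso, Category.comp_id] using this

lemma whiskerLeft_mem_balancedEnd {X : C} {f : End X} (hf : f ∈ balancedEnd X) (Y : C) :
    (show End (Y ⊗ X) from Y ◁ (f : X ⟶ X)) ∈ balancedEnd (Y ⊗ X) :=
  conj_mem_balancedEnd (β_ X Y) (whiskerRight_mem_balancedEnd hf Y)
    (BraidedCategory.braiding_naturality_left _ _)

variable (Φ : TensorMultiplicativeSet C)

/-- Pairs `(X, f)` with `X ∈ Φ` and `f ∈ E_X`. -/
structure BalancedPair where
  obj : C
  obj_mem : obj ∈ Φ.carrier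
  hom : End obj
  hom_mem : hom ∈ balancedEnd obj

variable {Φ}

namespace BalancedPair

/-- The pair `(a ⊗ X, a ⊗ f)`. -/
def tensorLeft (a : C) (ha : a ∈ Φ.carrier) (x : BalancedPair Φ) : BalancedPair Φ where
  obj := a ⊗ x.obj
  obj_mem := Φ.tensor_mem _ ha _ x.obj_mem
  hom := a ◁ (x.hom : x.obj ⟶ x.obj)
  hom_mem := whiskerLeft_mem_balancedEnd x.hom_mem a

/-- The pair `(X ⊗ a, f ⊗ a)`. -/
def tensorRight (x : BalancedPair Φ) (a : C) (ha : a ∈ Φ.carrier) : BalancedPair Φ where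
  obj := x.obj ⊗ a
  obj_mem := Φ.tensor_mem _ x.obj_mem _ ha
  hom := (x.hom : x.obj ⟶ x.obj) ▷ a
  hom_mem := whiskerRight_mem_balancedEnd x.hom_mem a

/-- The generating relation: `(X, f) ∼ (a ⊗ X, a ⊗ f)` and `(X, f) ∼ (X ⊗ a, f ⊗ a)` for `a ∈ Φ`. -/
inductive Rel : BalancedPair Φ → BalancedPair Φ → Prop
  | left (x : BalancedPair Φ) (a : C) (ha : a ∈ Φ.carrier) : Rel x (x.tensorLeft a ha)
  | right (x : BalancedPair Φ) (a : C) (ha : a ∈ Φ.carrier) : Rel x (x.tensorRight a ha)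

/-- The pair `(X ⊗ Y, f ⊗ Y + X ⊗ g)`. -/
def add (x y : BalancedPair Φ) : BalancedPair Φ where
  obj := x.obj ⊗ y.obj
  obj_mem := Φ.tensor_mem _ x.obj_mem _ y.obj_mem
  hom := (show End (x.obj ⊗ y.obj) from (x.hom : x.obj ⟶ x.obj) ▷ y.obj) +
    (show End (x.obj ⊗ y.obj) from x.obj ◁ (y.hom : y.obj ⟶ y.obj))
  hom_mem := add_mem (whiskerRight_mem_balancedEnd x.hom_mem _)
    (whiskerLeft_mem_balancedEnd y.hom_mem _)

/-- The pair `(X ⊗ Y, (f ⊗ Y) ∘ (X ⊗ g))`. -/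
def mul (x y : BalancedPair Φ) : BalancedPair Φ where
  obj := x.obj ⊗ y.obj
  obj_mem := Φ.tensor_mem _ x.obj_mem _ y.obj_mem
  hom := (show End (x.obj ⊗ y.obj) from (x.hom : x.obj ⟶ x.obj) ▷ y.obj) *
    (show End (x.obj ⊗ y.obj) from x.obj ◁ (y.hom : y.obj ⟶ y.obj))
  hom_mem := mul_mem (whiskerRight_mem_balancedEnd x.hom_mem _)
    (whiskerLeft_mem_balancedEnd y.hom_mem _)

/-- The pair `(X, -f)`. -/
def neg (x : BalancedPair Φ) : BalancedPair Φ where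
  obj := x.obj
  obj_mem := x.obj_mem
  hom := -x.hom
  hom_mem := neg_mem x.hom_mem

end BalancedPair

variable (Φ) in
/-- `R_Φ`: the quotient of the set of pairs `(X, f)` by the smallest equivalence relation containing
the generating relation. -/
def RingR : Type (max u v) := Quot (BalancedPair.Rel (Φ := Φ))

namespace RingR

/-- The class of a pair. -/
def mk (x : BalancedPair Φ) : RingR Φ := Quot.mk _ x

lemma mk_tensorLeft (x : BalancedPair Φ) (a : C) (ha : a ∈ Φ.carrier) :
    mk (x.tensorLeft a ha) = mk x := (Quot.sound (.left x a ha)).symm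

lemma mk_tensorRight (x : BalancedPair Φ) (a : C) (ha : a ∈ Φ.carrier) :
    mk (x.tensorRight a ha) = mk x := (Quot.sound (.right x a ha)).symm

lemma mk_congr {X : C} {hX hX'} {f g : End X} {hf hg} (h : f = g) :
    mk (⟨X, hX, f, hf⟩ : BalancedPair Φ) = mk ⟨X, hX', g, hg⟩ := by subst h; rfl

/-- Pairs which are conjugate under an isomorphism have the same class. -/
lemma mk_eq_of_iso {x y : BalancedPair Φ} (e : x.obj ≅ y.obj)
    (h : (x.hom : x.obj ⟶ x.obj) ≫ e.hom = e.hom ≫ (y.hom : y.obj ⟶ y.obj)) : mk x = mk y := by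
  rw [← mk_tensorRight x y.obj y.obj_mem, ← mk_tensorLeft y x.obj x.obj_mem]
  refine mk_congr ?_
  have hx := mem_balancedEnd.1 x.hom_mem
  have hy : (y.hom : y.obj ⟶ y.obj) = e.inv ≫ x.hom ≫ e.hom := by rw [h]; simp
  change (x.hom : x.obj ⟶ x.obj) ▷ y.obj = x.obj ◁ (y.hom : y.obj ⟶ y.obj)
  rw [hy, MonoidalCategory.whiskerLeft_comp, MonoidalCategory.whiskerLeft_comp, ← hx,
    ← whisker_exchange, ← MonoidalCategory.whiskerLeft_comp_assoc]
  simp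

lemma add_comm_aux (x y : BalancedPair Φ) : mk (x.add y) = mk (y.add x) := by
  refine mk_eq_of_iso (β_ x.obj y.obj) ?_
  change ((x.hom : x.obj ⟶ x.obj) ▷ y.obj + x.obj ◁ (y.hom : y.obj ⟶ y.obj)) ≫ _ =
    _ ≫ ((y.hom : y.obj ⟶ y.obj) ▷ x.obj + y.obj ◁ (x.hom : x.obj ⟶ x.obj))
  rw [Preadditive.add_comp, Preadditive.comp_add, BraidedCategory.braiding_naturality_left,
    BraidedCategory.braiding_naturality_right, add_comm]

lemma mul_comm_aux (x y : BalancedPair Φ) : mk (x.mul y) = mk (y.mul x) := by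
  refine mk_eq_of_iso (β_ x.obj y.obj) ?_
  change (x.obj ◁ (y.hom : y.obj ⟶ y.obj) ≫ (x.hom : x.obj ⟶ x.obj) ▷ y.obj) ≫ _ =
    _ ≫ (y.obj ◁ (x.hom : x.obj ⟶ x.obj) ≫ (y.hom : y.obj ⟶ y.obj) ▷ x.obj)
  rw [whisker_exchange, Category.assoc, BraidedCategory.braiding_naturality_right,
    BraidedCategory.braiding_naturality_left_assoc]

lemma add_tensorLeft_aux (x y : BalancedPair Φ) (a : C) (ha : a ∈ Φ.carrier) :
    mk ((x.tensorLeft a ha).add y) = mk (x.add y) := by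
  rw [← mk_tensorLeft (x.add y) a ha]
  refine mk_eq_of_iso (α_ a x.obj y.obj) ?_
  change ((a ◁ (x.hom : x.obj ⟶ x.obj)) ▷ y.obj + (a ⊗ x.obj) ◁ (y.hom : y.obj ⟶ y.obj)) ≫ _ =
    _ ≫ (a ◁ ((x.hom : x.obj ⟶ x.obj) ▷ y.obj + x.obj ◁ (y.hom : y.obj ⟶ y.obj)))
  rw [Preadditive.add_comp, MonoidalPreadditive.whiskerLeft_add, Preadditive.comp_add]
  simp

lemma mul_tensorLeft_aux (x y : BalancedPair Φ) (a : C) (ha : a ∈ Φ.carrier) :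
    mk ((x.tensorLeft a ha).mul y) = mk (x.mul y) := by
  rw [← mk_tensorLeft (x.mul y) a ha]
  refine mk_eq_of_iso (α_ a x.obj y.obj) ?_
  change ((a ⊗ x.obj) ◁ (y.hom : y.obj ⟶ y.obj) ≫ (a ◁ (x.hom : x.obj ⟶ x.obj)) ▷ y.obj) ≫ _ =
    _ ≫ (a ◁ (x.obj ◁ (y.hom : y.obj ⟶ y.obj) ≫ (x.hom : x.obj ⟶ x.obj) ▷ y.obj))
  simp

lemma add_tensorRight_aux (x y : BalancedPair Φ) (a : C) (ha : a ∈ Φ.carrier) :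
    mk ((x.tensorRight a ha).add y) = mk (x.add y) := by
  rw [← add_tensorLeft_aux x y a ha]
  refine mk_eq_of_iso (whiskerRightIso (β_ x.obj a) y.obj) ?_
  change ((x.hom : x.obj ⟶ x.obj) ▷ a ▷ y.obj + (x.obj ⊗ a) ◁ (y.hom : y.obj ⟶ y.obj)) ≫
      (β_ x.obj a).hom ▷ y.obj =
    (β_ x.obj a).hom ▷ y.obj ≫
      ((a ◁ (x.hom : x.obj ⟶ x.obj)) ▷ y.obj + (a ⊗ x.obj) ◁ (y.hom : y.obj ⟶ y.obj))
  rw [Preadditive.add_comp, Preadditive.comp_add, ← comp_whiskerRight, ← comp_whiskerRight,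
    BraidedCategory.braiding_naturality_left, whisker_exchange]

lemma mul_tensorRight_aux (x y : BalancedPair Φ) (a : C) (ha : a ∈ Φ.carrier) :
    mk ((x.tensorRight a ha).mul y) = mk (x.mul y) := by
  rw [← mul_tensorLeft_aux x y a ha]
  refine mk_eq_of_iso (whiskerRightIso (β_ x.obj a) y.obj) ?_
  change ((x.obj ⊗ a) ◁ (y.hom : y.obj ⟶ y.obj) ≫ (x.hom : x.obj ⟶ x.obj) ▷ a ▷ y.obj) ≫
      (β_ x.obj a).hom ▷ y.obj =
    (β_ x.obj a).hom ▷ y.obj ≫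
      ((a ⊗ x.obj) ◁ (y.hom : y.obj ⟶ y.obj) ≫ (a ◁ (x.hom : x.obj ⟶ x.obj)) ▷ y.obj)
  rw [Category.assoc, ← comp_whiskerRight, BraidedCategory.braiding_naturality_left,
    comp_whiskerRight, whisker_exchange_assoc]

lemma add_rel {x x' : BalancedPair Φ} (h : BalancedPair.Rel x x') (y : BalancedPair Φ) :
    mk (x.add y) = mk (x'.add y) := by
  cases h with
  | left a ha => exact (add_tensorLeft_aux x y a ha).symm
  | right a ha => exact (add_tensorRight_aux x y a ha).symm

lemma mul_rel {x x' : BalancedPair Φ} (h : BalancedPair.Rel x x') (y : BalancedPair Φ) :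
    mk (x.mul y) = mk (x'.mul y) := by
  cases h with
  | left a ha => exact (mul_tensorLeft_aux x y a ha).symm
  | right a ha => exact (mul_tensorRight_aux x y a ha).symm

lemma neg_rel {x x' : BalancedPair Φ} (h : BalancedPair.Rel x x') :
    mk x.neg = mk x'.neg := by
  cases h with
  | left a ha =>
    rw [← mk_tensorLeft x.neg a ha]
    exact mk_congr ((CategoryTheory.MonoidalCategory.tensorLeft a).map_neg
      (f := (x.hom : x.obj ⟶ x.obj)))
  | right a ha =>
    rw [← mk_tensorRight x.neg a ha]
    exact mk_congr ((CategoryTheory.MonoidalCategory.tensorRight a).map_neg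
      (f := (x.hom : x.obj ⟶ x.obj)))

instance : Add (RingR Φ) where
  add := Quot.lift₂ (fun x y => mk (x.add y))
    (fun x y y' h => by rw [add_comm_aux x y, add_comm_aux x y']; exact add_rel h x)
    (fun x x' y h => add_rel h y)

instance : Mul (RingR Φ) where
  mul := Quot.lift₂ (fun x y => mk (x.mul y))
    (fun x y y' h => by rw [mul_comm_aux x y, mul_comm_aux x y']; exact mul_rel h x)
    (fun x x' y h => mul_rel h y)

instance : Neg (RingR Φ) where
  neg := Quot.lift (fun x => mk x.neg) (fun _ _ h => neg_rel h)

variable (Φ) in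
/-- The class of an element of `E_X`, for `X ∈ Φ`. -/
def of (X : C) (hX : X ∈ Φ.carrier) (f : balancedEnd X) : RingR Φ := mk ⟨X, hX, f.1, f.2⟩

instance : Zero (RingR Φ) where
  zero := of Φ Φ.nonempty.some Φ.nonempty.some_mem 0

instance : One (RingR Φ) where
  one := of Φ Φ.nonempty.some Φ.nonempty.some_mem 1

lemma mk_add_mk (x y : BalancedPair Φ) : mk x + mk y = mk (x.add y) := rfl

lemma mk_mul_mk (x y : BalancedPair Φ) : mk x * mk y = mk (x.mul y) := rfl

lemma neg_mk (x : BalancedPair Φ) : -mk x = mk x.neg := rfl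

lemma of_add (X : C) (hX : X ∈ Φ.carrier) (f g : balancedEnd X) :
    of Φ X hX (f + g) = of Φ X hX f + of Φ X hX g := by
  rw [of, of, of, mk_add_mk, ← mk_tensorRight _ X hX]
  refine mk_congr ?_
  change ((f.1 + g.1 : X ⟶ X)) ▷ X = (f.1 : X ⟶ X) ▷ X + X ◁ (g.1 : X ⟶ X)
  rw [MonoidalPreadditive.add_whiskerRight, mem_balancedEnd.1 g.2]

lemma of_mul (X : C) (hX : X ∈ Φ.carrier) (f g : balancedEnd X) :
    of Φ X hX (f * g) = of Φ X hX f * of Φ X hX g := by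
  rw [of, of, of, mk_mul_mk, ← mk_tensorRight _ X hX]
  refine mk_congr ?_
  change ((g.1 : X ⟶ X) ≫ (f.1 : X ⟶ X)) ▷ X = X ◁ (g.1 : X ⟶ X) ≫ (f.1 : X ⟶ X) ▷ X
  rw [comp_whiskerRight, mem_balancedEnd.1 g.2]

lemma of_neg (X : C) (hX : X ∈ Φ.carrier) (f : balancedEnd X) :
    of Φ X hX (-f) = -of Φ X hX f := rfl

lemma of_zero (X : C) (hX : X ∈ Φ.carrier) : of Φ X hX 0 = 0 := by
  change mk _ = mk _
  rw [← mk_tensorRight _ Φ.nonempty.some Φ.nonempty.some_mem,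
    ← mk_tensorLeft ⟨Φ.nonempty.some, _, _, _⟩ X hX]
  refine mk_congr ?_
  change (0 : X ⟶ X) ▷ Φ.nonempty.some = X ◁ (0 : Φ.nonempty.some ⟶ Φ.nonempty.some)
  simp

lemma of_one (X : C) (hX : X ∈ Φ.carrier) : of Φ X hX 1 = 1 := by
  change mk _ = mk _
  rw [← mk_tensorRight _ Φ.nonempty.some Φ.nonempty.some_mem,
    ← mk_tensorLeft ⟨Φ.nonempty.some, _, _, _⟩ X hX]
  refine mk_congr ?_
  change (𝟙 X) ▷ Φ.nonempty.some = X ◁ (𝟙 Φ.nonempty.some)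
  simp

/-- Any three elements come from a common ring `E_X`. -/
lemma exists_of₃ (r s t : RingR Φ) :
    ∃ (X : C) (hX : X ∈ Φ.carrier) (f g h : balancedEnd X),
      r = of Φ X hX f ∧ s = of Φ X hX g ∧ t = of Φ X hX h := by
  induction r using Quot.ind with | _ x => ?_
  induction s using Quot.ind with | _ y => ?_
  induction t using Quot.ind with | _ z => ?_
  have hyz := Φ.tensor_mem _ y.obj_mem _ z.obj_mem
  refine ⟨x.obj ⊗ (y.obj ⊗ z.obj), Φ.tensor_mem _ x.obj_mem _ hyz,
    ⟨_, (x.tensorRight _ hyz).hom_mem⟩,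
    ⟨_, ((y.tensorRight _ z.obj_mem).tensorLeft _ x.obj_mem).hom_mem⟩,
    ⟨_, ((z.tensorLeft _ y.obj_mem).tensorLeft _ x.obj_mem).hom_mem⟩, ?_, ?_, ?_⟩
  · exact (mk_tensorRight x _ hyz).symm
  · exact ((mk_tensorLeft _ _ x.obj_mem).trans (mk_tensorRight y _ z.obj_mem)).symm
  · exact ((mk_tensorLeft _ _ x.obj_mem).trans (mk_tensorLeft z _ y.obj_mem)).symm

/-- `R_Φ` is a commutative ring, with `[f_X] + [g_Y] = [f ⊗ Y + X ⊗ g]` and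
`[f_X] * [g_Y] = [(f ⊗ Y) ∘ (X ⊗ g)]`. -/
instance : CommRing (RingR Φ) where
  add_assoc r s t := by
    obtain ⟨X, hX, f, g, h, rfl, rfl, rfl⟩ := exists_of₃ r s t
    simp only [← of_add, add_assoc]
  zero_add r := by
    obtain ⟨X, hX, f, -, -, rfl, -, -⟩ := exists_of₃ r r r
    rw [← of_zero X hX, ← of_add, zero_add]
  add_zero r := by
    obtain ⟨X, hX, f, -, -, rfl, -, -⟩ := exists_of₃ r r r
    rw [← of_zero X hX, ← of_add, add_zero]
  add_comm r s := by
    obtain ⟨X, hX, f, g, -, rfl, rfl, -⟩ := exists_of₃ r s s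
    rw [← of_add, ← of_add, add_comm]
  neg_add_cancel r := by
    obtain ⟨X, hX, f, -, -, rfl, -, -⟩ := exists_of₃ r r r
    rw [← of_neg, ← of_add, neg_add_cancel, of_zero]
  mul_assoc r s t := by
    obtain ⟨X, hX, f, g, h, rfl, rfl, rfl⟩ := exists_of₃ r s t
    simp only [← of_mul, mul_assoc]
  one_mul r := by
    obtain ⟨X, hX, f, -, -, rfl, -, -⟩ := exists_of₃ r r r
    rw [← of_one X hX, ← of_mul, one_mul]
  mul_one r := by
    obtain ⟨X, hX, f, -, -, rfl, -, -⟩ := exists_of₃ r r r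
    rw [← of_one X hX, ← of_mul, mul_one]
  zero_mul r := by
    obtain ⟨X, hX, f, -, -, rfl, -, -⟩ := exists_of₃ r r r
    rw [← of_zero X hX, ← of_mul, zero_mul]
  mul_zero r := by
    obtain ⟨X, hX, f, -, -, rfl, -, -⟩ := exists_of₃ r r r
    rw [← of_zero X hX, ← of_mul, mul_zero]
  left_distrib r s t := by
    obtain ⟨X, hX, f, g, h, rfl, rfl, rfl⟩ := exists_of₃ r s t
    simp only [← of_mul, ← of_add, mul_add]
  right_distrib r s t := by
    obtain ⟨X, hX, f, g, h, rfl, rfl, rfl⟩ := exists_of₃ r s t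
    simp only [← of_mul, ← of_add, add_mul]
  mul_comm r s := by
    induction r using Quot.ind with | _ x => ?_
    induction s using Quot.ind with | _ y => ?_
    exact mul_comm_aux x y
  nsmul := nsmulRec
  zsmul := zsmulRec

end RingR

end Ring

/-- `Z_Φ`: the intersection of the supports of the objects of `Φ`. -/
def suppSet {C : Type u} [Category.{v} C] [HasZeroObject C] [HasShift C ℤ] [Preadditive C]
    [∀ n : ℤ, (shiftFunctor C n).Additive] [Pretriangulated C]
    [MonoidalCategory C] [SymmetricCategory C] (Φ : TensorMultiplicativeSet C) : Set (Spc C) :=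
  ⋂ X ∈ Φ.carrier, supp X

end TTGeom

end

/-! A separation of `Z_Φ` should produce a non-trivial idempotent of `R_Φ`. Suppose the closed set
`Z_Φ` is covered by disjoint closed sets `u` and `v`. They lie in the supports of objects `a` and
`b` with `a ⊗ b = 0` (`exists_isZero_tensor_of_disjoint`). Let `Q` be the annihilator of `a` and `P`
the annihilator of `Q`. These are thick tensor ideals with `a ∈ P`, `b ∈ Q` and `P ⊗ Q = 0`, and
duality turns the last fact into the vanishing of all morphisms between `P` and `Q`, in both
directions.

Orthogonality makes the summands of sums `x ⊕ y`, with `x ∈ P` and `y ∈ Q`, a thick tensor ideal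
(`isThickTensorIdeal_retractSum`). It contains `a` and `b`, so it lies in no prime of `Z_Φ`; by the
Zorn argument of `exists_le_prime_of_disjoint` it meets `Φ` in some `X`. The projection of `X` to
its `P`-part is a balanced idempotent. Its class in `R_Φ` is `0` or `1`, so some object of `Φ` lies
in `Q` or in `P`; accordingly `Z_Φ` misses `u` or `v`. -/

namespace TTGeom

open scoped ZeroObject

/-! ### Thick tensor ideals -/

section ThickIdeal

variable {C : Type u} [Category.{v} C] [HasZeroObject C] [HasShift C ℤ] [Preadditive C]
  [∀ n : ℤ, (shiftFunctor C n).Additive] [Pretriangulated C] [MonoidalCategory C]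

/-- Thick tensor ideals: thick triangulated subcategories which are stable under tensoring (on the
left) with arbitrary objects. -/
structure IsThickTensorIdeal (P : ObjectProperty C) : Prop where
  zero_mem {a : C} : IsZero a → P a
  shift_mem {a : C} (n : ℤ) : P a → P (a⟦n⟧)
  ext_mem {T : Triangle C} : T ∈ distTriang C → P T.obj₁ → P T.obj₃ → P T.obj₂
  retract_mem {a b : C} : Retract a b → P b → P a
  tensor_mem (a : C) {b : C} : P b → P (a ⊗ b)

namespace IsThickTensorIdeal

variable {P : ObjectProperty C}

lemma iso_mem (hP : IsThickTensorIdeal P) {a b : C} (e : a ≅ b) (h : P a) : P b :=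
  hP.retract_mem e.symm.retract h

lemma isStableUnderRetracts (hP : IsThickTensorIdeal P) : P.IsStableUnderRetracts where
  of_retract := hP.retract_mem

lemma isClosedUnderIsomorphisms (hP : IsThickTensorIdeal P) : P.IsClosedUnderIsomorphisms where
  of_iso := hP.iso_mem

lemma isTriangulated (hP : IsThickTensorIdeal P) : P.IsTriangulated :=
  have := hP.isClosedUnderIsomorphisms
  { exists_zero := ⟨0, isZero_zero C, hP.zero_mem (isZero_zero C)⟩
    isStableUnderShiftBy n := ⟨fun _ h => hP.shift_mem n h⟩
    toIsTriangulatedClosed₂ := .mk' fun _ hT h₁ h₃ => hP.ext_mem hT h₁ h₃ }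

lemma tensor_mem_right [BraidedCategory C] (hP : IsThickTensorIdeal P) {a : C} (b : C)
    (h : P a) : P (a ⊗ b) :=
  hP.iso_mem (β_ b a) (hP.tensor_mem b h)

lemma forall_mem {ι : Sort*} {P : ι → ObjectProperty C} (hP : ∀ i, IsThickTensorIdeal (P i)) :
    IsThickTensorIdeal fun a => ∀ i, P i a where
  zero_mem h i := (hP i).zero_mem h
  shift_mem n h i := (hP i).shift_mem n (h i)
  ext_mem hT h₁ h₃ i := (hP i).ext_mem hT (h₁ i) (h₃ i)
  retract_mem r h i := (hP i).retract_mem r (h i)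
  tensor_mem a _ h i := (hP i).tensor_mem a (h i)

/-- Supplies the upper bounds for Zorn's lemma. Comparability is needed only for extensions, whose
two outer terms may come from different members of the chain. -/
lemma exists_mem_of_isChain {c : Set (ObjectProperty C)} (hc : IsChain (· ≤ ·) c)
    (hne : c.Nonempty) (h : ∀ P ∈ c, IsThickTensorIdeal P) :
    IsThickTensorIdeal fun a => ∃ P ∈ c, P a where
  zero_mem ha := ⟨_, hne.some_mem, (h _ hne.some_mem).zero_mem ha⟩
  shift_mem n := fun ⟨P, hP, ha⟩ => ⟨P, hP, (h P hP).shift_mem n ha⟩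
  ext_mem hT := by
    rintro ⟨P, hP, h₁⟩ ⟨Q, hQ, h₃⟩
    rcases hc.total hP hQ with hPQ | hQP
    · exact ⟨Q, hQ, (h Q hQ).ext_mem hT (hPQ _ h₁) h₃⟩
    · exact ⟨P, hP, (h P hP).ext_mem hT h₁ (hQP _ h₃)⟩
  retract_mem r := fun ⟨P, hP, hb⟩ => ⟨P, hP, (h P hP).retract_mem r hb⟩
  tensor_mem a _ := fun ⟨P, hP, hb⟩ => ⟨P, hP, (h P hP).tensor_mem a hb⟩

end IsThickTensorIdeal

lemma isThickTensorIdeal_isZero [MonoidalPreadditive C] :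
    IsThickTensorIdeal (fun a : C => IsZero a) where
  zero_mem h := h
  shift_mem n h := (shiftFunctor C n).map_isZero h
  ext_mem hT h₁ h₃ := Triangle.isZero₂_of_isZero₁₃ _ hT h₁ h₃
  retract_mem r h := (IsZero.iff_id_eq_zero _).2 (by
    rw [← r.retract, h.eq_zero_of_tgt r.i, zero_comp])
  tensor_mem a _ h := (tensorLeft a).map_isZero h

/-- The biproduct of two objects of a thick tensor ideal. -/
lemma IsThickTensorIdeal.biprod_mem {P : ObjectProperty C} (hP : IsThickTensorIdeal P) {a b : C}
    (ha : P a) (hb : P b) : P (a ⊞ b) :=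
  hP.ext_mem (binaryBiproductTriangle_distinguished a b) ha hb

variable [SymmetricCategory C] [(curriedTensor C).CommShift₂Int] [TensorTriangulated C]

/-- This is the preimage of an ideal under the exact functor `- ⊗ b`, the analogue of a colon ideal
`(P : b)`. It serves both for annihilators and for primality. -/
lemma IsThickTensorIdeal.tensorRight {P : ObjectProperty C} (hP : IsThickTensorIdeal P) (b : C) :
    IsThickTensorIdeal fun a => P (a ⊗ b) where
  zero_mem h :=
    have : (CategoryTheory.MonoidalCategory.tensorRight b).IsTriangulated :=
      TensorTriangulated.exact_tensorRight b
    hP.zero_mem ((CategoryTheory.MonoidalCategory.tensorRight b).map_isZero h)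
  shift_mem {a} n h := hP.iso_mem
    (((CategoryTheory.MonoidalCategory.tensorRight b).commShiftIso n).app a).symm
    (hP.shift_mem n h)
  ext_mem {T} hT h₁ h₃ :=
    have : (CategoryTheory.MonoidalCategory.tensorRight b).IsTriangulated :=
      TensorTriangulated.exact_tensorRight b
    hP.ext_mem ((CategoryTheory.MonoidalCategory.tensorRight b).map_distinguished T hT) h₁ h₃
  retract_mem r h := hP.retract_mem (r.map (CategoryTheory.MonoidalCategory.tensorRight b)) h
  tensor_mem a c h := hP.iso_mem (α_ a c b).symm (hP.tensor_mem a h)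

/-- The objects annihilated by all the objects satisfying `T`. -/
def annihilator (T : ObjectProperty C) : ObjectProperty C := fun a => ∀ b, T b → IsZero (a ⊗ b)

lemma isThickTensorIdeal_annihilator [MonoidalPreadditive C] (T : ObjectProperty C) :
    IsThickTensorIdeal (annihilator T) :=
  .forall_mem fun b => .forall_mem fun _ => isThickTensorIdeal_isZero.tensorRight b

end ThickIdeal

/-! ### Existence of primes -/

section Primes

variable {C : Type u} [Category.{v} C] [HasZeroObject C] [HasShift C ℤ] [Preadditive C]
  [∀ n : ℤ, (shiftFunctor C n).Additive] [Pretriangulated C] [MonoidalCategory C]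

namespace Spc

lemma isThickTensorIdeal (P : Spc C) : IsThickTensorIdeal P.mem :=
  have := P.isTriangulated
  have := P.isClosedUnderIsomorphisms
  have := P.isStableUnderRetracts
  { zero_mem h := P.mem.prop_of_isZero h
    shift_mem n h := P.mem.le_shift n _ h
    ext_mem hT h₁ h₃ := P.mem.ext_of_isTriangulatedClosed₂ _ hT h₁ h₃
    retract_mem r h := P.mem.prop_of_retract r h
    tensor_mem a _ h := P.tensor_mem a _ h }

/-- Open neighbourhoods of a prime contain a basic one. -/
lemma exists_mem_of_isOpen {U : Set (Spc C)} (hU : IsOpen U) {P : Spc C} (hP : P ∈ U) :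
    ∃ a : C, P.mem a ∧ (supp a)ᶜ ⊆ U := by
  induction hU with
  | basic s hs =>
    obtain ⟨a, rfl⟩ := hs
    exact ⟨a, not_not.1 hP, le_rfl⟩
  | univ => exact ⟨0, P.isThickTensorIdeal.zero_mem (isZero_zero C), Set.subset_univ _⟩
  | inter s t _ _ hs ht =>
    obtain ⟨a, ha, has⟩ := hs hP.1
    obtain ⟨b, hb, hbt⟩ := ht hP.2
    -- A prime containing `a ⊞ b` contains both summands.
    refine ⟨a ⊞ b, P.isThickTensorIdeal.biprod_mem ha hb, fun Q hQ => ⟨has ?_, hbt ?_⟩⟩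
    · exact fun h => h (Q.isThickTensorIdeal.retract_mem
        ⟨biprod.inl, biprod.fst, biprod.inl_fst⟩ (not_not.1 hQ))
    · exact fun h => h (Q.isThickTensorIdeal.retract_mem
        ⟨biprod.inr, biprod.snd, biprod.inr_snd⟩ (not_not.1 hQ))
  | sUnion S _ ih =>
    obtain ⟨s, hs, hPs⟩ := hP
    obtain ⟨a, ha, has⟩ := ih s hs hPs
    exact ⟨a, ha, has.trans (Set.subset_sUnion_of_mem hs)⟩

end Spc

lemma isClosed_supp (a : C) : IsClosed (supp a) :=
  ⟨TopologicalSpace.isOpen_generateFrom_of_mem ⟨a, rfl⟩⟩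

lemma supp_unit : supp (𝟙_ C) = Set.univ := by
  refine Set.eq_univ_of_forall fun P hP => ?_
  obtain ⟨a, ha⟩ := P.proper
  exact ha (P.isThickTensorIdeal.iso_mem (ρ_ a) (P.tensor_mem a _ hP))

lemma supp_eq_empty_of_isZero {a : C} (h : IsZero a) : supp a = ∅ :=
  Set.eq_empty_of_forall_notMem fun P hP => hP (P.isThickTensorIdeal.zero_mem h)

variable [SymmetricCategory C]

lemma isClosed_suppSet (Φ : TensorMultiplicativeSet C) : IsClosed (suppSet Φ) :=
  isClosed_biInter fun a _ => isClosed_supp a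

lemma mem_suppSet {Φ : TensorMultiplicativeSet C} {P : Spc C} :
    P ∈ suppSet Φ ↔ ∀ a ∈ Φ.carrier, ¬ P.mem a := by
  simp [suppSet, supp]

lemma supp_tensor (a b : C) : supp (a ⊗ b) = supp a ∩ supp b := by
  ext P
  refine ⟨fun h => ⟨fun ha => h (P.isThickTensorIdeal.tensor_mem_right b ha),
    fun hb => h (P.tensor_mem a b hb)⟩, fun h hab => ?_⟩
  exact (P.prime a b hab).elim h.1 h.2

variable [(curriedTensor C).CommShift₂Int] [TensorTriangulated C]

/-- A thick tensor ideal which does not meet a tensor-multiplicative set is contained in a prime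
which does not meet it either. -/
theorem exists_le_prime_of_disjoint {J : ObjectProperty C} (hJ : IsThickTensorIdeal J)
    (S : TensorMultiplicativeSet C) (h : ∀ a ∈ S.carrier, ¬ J a) :
    ∃ P ∈ suppSet S, J ≤ P.mem := by
  obtain ⟨P, hJP, hmax⟩ := zorn_le_nonempty₀
    {Q : ObjectProperty C | IsThickTensorIdeal Q ∧ ∀ a ∈ S.carrier, ¬ Q a}
    (fun c hc hchain Q hQ => ⟨fun a => ∃ R ∈ c, R a,
      ⟨.exists_mem_of_isChain hchain ⟨Q, hQ⟩ fun R hR => (hc hR).1,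
        fun a ha ⟨R, hR, hRa⟩ => (hc hR).2 a ha hRa⟩,
      fun R hR a ha => ⟨R, hR, ha⟩⟩) J ⟨hJ, h⟩
  have hP := hmax.prop.1
  -- The colon ideal `(P : b)` contains `P`, and strictly because of `a`, so maximality forces it to
  -- meet `S`. Using this twice replaces both factors of a product in `P` by elements of `S`.
  have key {b a : C} (hab : P (a ⊗ b)) (ha : ¬ P a) : ∃ s ∈ S.carrier, P (s ⊗ b) := by
    by_contra! hdis
    exact ha (hmax.le_of_ge ⟨hP.tensorRight b, hdis⟩
      (fun x hx => hP.tensor_mem_right b hx) a hab)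
  refine ⟨⟨P, hP.isTriangulated, hP.isClosedUnderIsomorphisms, hP.isStableUnderRetracts,
    fun a _ hb => hP.tensor_mem a hb, ⟨_, hmax.prop.2 _ S.nonempty.some_mem⟩, fun a b hab => ?_⟩,
    mem_suppSet.2 hmax.prop.2, hJP⟩
  by_contra! hne
  obtain ⟨s, hs, hsb⟩ := key hab hne.1
  obtain ⟨t, ht, hts⟩ := key (hP.iso_mem (β_ s b) hsb) hne.2
  exact hmax.prop.2 _ (S.tensor_mem t ht s hs) hts

/-- Disjoint closed subsets of the spectrum can be separated by supports of objects whose tensor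
product vanishes. -/
lemma exists_isZero_tensor_of_disjoint [MonoidalPreadditive C] {u v : Set (Spc C)}
    (hu : IsClosed u) (hv : IsClosed v) (huv : Disjoint u v) :
    ∃ a b : C, u ⊆ supp a ∧ v ⊆ supp b ∧ IsZero (a ⊗ b) := by
  -- Membership is up to isomorphism because `(a ⊗ b) ⊗ (c ⊗ d)` is only isomorphic to `(a ⊗ c) ⊗ (b
  -- ⊗ d)`.
  let S : TensorMultiplicativeSet C :=
    { carrier := {x | ∃ a b : C, u ⊆ supp a ∧ v ⊆ supp b ∧ Nonempty (x ≅ a ⊗ b)}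
      nonempty := ⟨_, 𝟙_ C, 𝟙_ C, by simp [supp_unit], by simp [supp_unit], ⟨Iso.refl _⟩⟩
      tensor_mem := by
        rintro x ⟨a, b, ha, hb, ⟨e⟩⟩ y ⟨c, d, hc, hd, ⟨f⟩⟩
        refine ⟨a ⊗ c, b ⊗ d, ?_, ?_, ⟨(e ⊗ᵢ f) ≪≫
          ⟨tensorμ a b c d, tensorδ a b c d, tensorμ_tensorδ .., tensorδ_tensorμ ..⟩⟩⟩
        · rw [supp_tensor]
          exact Set.subset_inter ha hc
        · rw [supp_tensor]
          exact Set.subset_inter hb hd }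
  by_contra! hne
  obtain ⟨P, hP, -⟩ := exists_le_prime_of_disjoint isThickTensorIdeal_isZero S (by
    rintro x ⟨a, b, ha, hb, ⟨e⟩⟩ hx
    exact hne a b ha hb (hx.of_iso e.symm))
  rw [mem_suppSet] at hP
  -- The prime `P` lies outside `u` or outside `v`. It then contains an object whose support
  -- contains that closed set; tensored with the unit, this object lies in `S`.
  by_cases hPu : P ∈ u
  · obtain ⟨b, hPb, hb⟩ := Spc.exists_mem_of_isOpen hv.isOpen_compl
      (fun hPv => huv.notMem_of_mem_left hPu hPv)
    exact hP _ ⟨𝟙_ C, b, by simp [supp_unit], Set.compl_subset_compl.1 hb, ⟨Iso.refl _⟩⟩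
      (P.tensor_mem _ _ hPb)
  · obtain ⟨a, hPa, ha⟩ := Spc.exists_mem_of_isOpen hu.isOpen_compl hPu
    exact hP _ ⟨a, 𝟙_ C, Set.compl_subset_compl.1 ha, by simp [supp_unit], ⟨Iso.refl _⟩⟩
      (P.isThickTensorIdeal.tensor_mem_right _ hPa)

end Primes

/-! ### Sums of orthogonal thick tensor ideals -/

section Sum

/-- In a right rigid braided category, `y ⊗ x = 0` implies that every morphism `x ⟶ y` vanishes. -/
lemma hom_eq_zero_of_isZero_tensor {C : Type u} [Category.{v} C] [Preadditive C]
    [MonoidalCategory C] [MonoidalPreadditive C] [BraidedCategory C] [RightRigidCategory C]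
    {x y : C} (h : IsZero (y ⊗ x)) (f : x ⟶ y) : f = 0 := by
  have hz : IsZero (y ⊗ (xᘁ ⊗ x)) :=
    ((tensorRight xᘁ).map_isZero h).of_iso (y ◁ᵢ (β_ xᘁ x) ≪≫ (α_ y x xᘁ).symm)
  -- The triangle identity makes `x` a retract of `x ⊗ (xᘁ ⊗ x)`. By interchange, `f` then passes
  -- through the zero object `y ⊗ (xᘁ ⊗ x)`.
  have hid : (λ_ x).inv ≫ η_ x xᘁ ▷ x ≫ (α_ x xᘁ x).hom ≫ x ◁ ε_ x xᘁ ≫ (ρ_ x).hom = 𝟙 x := by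
    have := ExactPairing.evaluation_coevaluation x xᘁ
    rw [reassoc_of% this]
    simp
  have hf : x ◁ ε_ x xᘁ ≫ (ρ_ x).hom ≫ f = 0 := by
    rw [← rightUnitor_naturality, whisker_exchange_assoc, hz.eq_zero_of_tgt (f ▷ _), zero_comp]
  rw [← Category.id_comp f, ← hid]
  simp only [Category.assoc, hf, comp_zero]

variable {C : Type u} [Category.{v} C] [HasZeroObject C] [HasShift C ℤ] [Preadditive C]
  [∀ n : ℤ, (shiftFunctor C n).Additive] [Pretriangulated C] [MonoidalCategory C]

/-- The direct summands of sums of an object satisfying `P` and one satisfying `Q`. -/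
def retractSum (P Q : ObjectProperty C) : ObjectProperty C := fun a =>
  ∃ (x y : C) (_ : P x) (_ : Q y) (i : a ⟶ x) (r : x ⟶ a) (j : a ⟶ y) (s : y ⟶ a),
    i ≫ r + j ≫ s = 𝟙 a

/-- Only closure under extensions needs orthogonality: the connecting morphism becomes diagonal, so
the middle term is a summand of the sum of an extension in `P` and an extension in `Q`. -/
lemma isThickTensorIdeal_retractSum [MonoidalPreadditive C] {P Q : ObjectProperty C}
    (hP : IsThickTensorIdeal P) (hQ : IsThickTensorIdeal Q)
    (hPQ : ∀ x y, P x → Q y → ∀ f : x ⟶ y, f = 0) (hQP : ∀ x y, P x → Q y → ∀ f : y ⟶ x, f = 0) :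
    IsThickTensorIdeal (retractSum P Q) where
  zero_mem {a} h := ⟨a, a, hP.zero_mem h, hQ.zero_mem h, 0, 0, 0, 0, h.eq_of_src _ _⟩
  shift_mem {a} n := by
    rintro ⟨x, y, hx, hy, i, r, j, s, h⟩
    refine ⟨_, _, hP.shift_mem n hx, hQ.shift_mem n hy, i⟦n⟧', r⟦n⟧', j⟦n⟧', s⟦n⟧', ?_⟩
    rw [← Functor.map_comp, ← Functor.map_comp, ← Functor.map_add, h, CategoryTheory.Functor.map_id]
  ext_mem {T} hT := by
    rintro ⟨x, y, hx, hy, i, r, j, s, h⟩ ⟨x', y', hx', hy', i', r', j', s', h'⟩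
    obtain ⟨z, f, g, hz⟩ := distinguished_cocone_triangle₂ (r' ≫ T.mor₃ ≫ i⟦(1 : ℤ)⟧')
    obtain ⟨w, k, l, hw⟩ := distinguished_cocone_triangle₂ (s' ≫ T.mor₃ ≫ j⟦(1 : ℤ)⟧')
    have hs : i⟦(1 : ℤ)⟧' ≫ r⟦(1 : ℤ)⟧' + j⟦(1 : ℤ)⟧' ≫ s⟦(1 : ℤ)⟧' = 𝟙 (T.obj₁⟦(1 : ℤ)⟧) := by
      rw [← Functor.map_comp, ← Functor.map_comp, ← Functor.map_add, h, CategoryTheory.Functor.map_id]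
    -- With the off-diagonal components zero, the given maps on the outer terms commute with the
    -- connecting morphisms and extend to the middle terms.
    have v₁ : s' ≫ T.mor₃ ≫ i⟦(1 : ℤ)⟧' = 0 := hQP _ _ (hP.shift_mem 1 hx) hy' _
    have v₂ : r' ≫ T.mor₃ ≫ j⟦(1 : ℤ)⟧' = 0 := hPQ _ _ hx' (hQ.shift_mem 1 hy) _
    obtain ⟨p, hp₁, hp₂⟩ : ∃ p : T.obj₂ ⟶ z, T.mor₁ ≫ p = i ≫ f ∧ T.mor₂ ≫ i' = p ≫ g :=
        complete_distinguished_triangle_morphism₂ T _ hT hz i i' (by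
      change T.mor₃ ≫ i⟦(1 : ℤ)⟧' = i' ≫ r' ≫ T.mor₃ ≫ i⟦(1 : ℤ)⟧'
      conv_lhs => rw [← Category.id_comp (T.mor₃ ≫ _), ← h']
      rw [Preadditive.add_comp, Category.assoc, Category.assoc, v₁, comp_zero, add_zero])
    obtain ⟨q, hq₁, hq₂⟩ : ∃ q : z ⟶ T.obj₂, f ≫ q = r ≫ T.mor₁ ∧ g ≫ r' = q ≫ T.mor₂ :=
        complete_distinguished_triangle_morphism₂ _ T hz hT r r' (by
      change (r' ≫ T.mor₃ ≫ i⟦(1 : ℤ)⟧') ≫ r⟦(1 : ℤ)⟧' = r' ≫ T.mor₃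
      rw [← Category.comp_id (r' ≫ T.mor₃), ← hs, Preadditive.comp_add]
      simp only [Category.assoc] at v₂ ⊢
      rw [reassoc_of% v₂]
      simp)
    obtain ⟨p', hp₁', hp₂'⟩ : ∃ p : T.obj₂ ⟶ w, T.mor₁ ≫ p = j ≫ k ∧ T.mor₂ ≫ j' = p ≫ l :=
        complete_distinguished_triangle_morphism₂ T _ hT hw j j' (by
      change T.mor₃ ≫ j⟦(1 : ℤ)⟧' = j' ≫ s' ≫ T.mor₃ ≫ j⟦(1 : ℤ)⟧'
      conv_lhs => rw [← Category.id_comp (T.mor₃ ≫ _), ← h']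
      rw [Preadditive.add_comp, Category.assoc, Category.assoc, v₂, comp_zero, zero_add])
    obtain ⟨q', hq₁', hq₂'⟩ : ∃ q : w ⟶ T.obj₂, k ≫ q = s ≫ T.mor₁ ∧ l ≫ s' = q ≫ T.mor₂ :=
        complete_distinguished_triangle_morphism₂ _ T hw hT s s' (by
      change (s' ≫ T.mor₃ ≫ j⟦(1 : ℤ)⟧') ≫ s⟦(1 : ℤ)⟧' = s' ≫ T.mor₃
      rw [← Category.comp_id (s' ≫ T.mor₃), ← hs, Preadditive.comp_add]
      simp only [Category.assoc] at v₁ ⊢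
      rw [reassoc_of% v₁]
      simp)
    -- The middle composite need not be the identity, but it is invertible since the outer ones are
    -- identities; its inverse corrects `q` and `q'`.
    let φ : T ⟶ T :=
      { hom₁ := 𝟙 _
        hom₂ := p ≫ q + p' ≫ q'
        hom₃ := 𝟙 _
        comm₁ := by
          rw [Preadditive.comp_add, reassoc_of% hp₁, reassoc_of% hp₁', hq₁, hq₁',
            ← Category.assoc, ← Category.assoc, ← Preadditive.add_comp, h]
        comm₂ := by
          rw [Preadditive.add_comp, Category.assoc, Category.assoc, ← hq₂, ← hq₂',
            ← reassoc_of% hp₂, ← reassoc_of% hp₂', ← Preadditive.comp_add, h'] }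
    have : IsIso φ.hom₂ := isIso₂_of_isIso₁₃ φ hT hT (inferInstanceAs (IsIso (𝟙 _)))
      (inferInstanceAs (IsIso (𝟙 _)))
    refine ⟨z, w, hP.ext_mem hz hx hx', hQ.ext_mem hw hy hy', p, q ≫ inv φ.hom₂, p',
      q' ≫ inv φ.hom₂, ?_⟩
    rw [← Category.assoc, ← Category.assoc, ← Preadditive.add_comp]
    exact IsIso.hom_inv_id φ.hom₂
  retract_mem {a b} t := by
    rintro ⟨x, y, hx, hy, i, r, j, s, h⟩
    refine ⟨x, y, hx, hy, t.i ≫ i, r ≫ t.r, t.i ≫ j, s ≫ t.r, ?_⟩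
    have : t.i ≫ (i ≫ r + j ≫ s) ≫ t.r = 𝟙 a := by rw [h]; simp
    simpa [Preadditive.add_comp, Preadditive.comp_add] using this
  tensor_mem a b := by
    rintro ⟨x, y, hx, hy, i, r, j, s, h⟩
    refine ⟨_, _, hP.tensor_mem a hx, hQ.tensor_mem a hy, a ◁ i, a ◁ r, a ◁ j, a ◁ s, ?_⟩
    rw [← MonoidalCategory.whiskerLeft_comp, ← MonoidalCategory.whiskerLeft_comp,
      ← MonoidalPreadditive.whiskerLeft_add, h, MonoidalCategory.whiskerLeft_id]

end Sum

/-! ### Vanishing in the ring attached to a tensor-multiplicative set -/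

section Ring

variable {C : Type u} [Category.{v} C] [MonoidalCategory C] [Preadditive C]

lemma whiskerRight_eq_zero_of_iso {X Y Z : C} {f : X ⟶ X} (e : Y ≅ Z) (h : f ▷ Y = 0) :
    f ▷ Z = 0 := by
  rw [← cancel_epi (X ◁ e.hom), whisker_exchange, h, zero_comp, comp_zero]

variable [MonoidalPreadditive C] [SymmetricCategory C]

/-- An endomorphism `f` is tensor-balanced if `f` and `1 - f` factor through objects whose tensor
product vanishes. -/
lemma mem_balancedEnd_of_isZero_tensor {X x y : C} (hxy : IsZero (x ⊗ y)) {i : X ⟶ x} {r : x ⟶ X}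
    {j : X ⟶ y} {s : y ⟶ X} (h : i ≫ r + j ≫ s = 𝟙 X) :
    (show End X from i ≫ r) ∈ balancedEnd X := by
  have h₁ : (i ≫ r) ⊗ₘ (j ≫ s) = 0 := by
    rw [← tensorHom_comp_tensorHom, hxy.eq_zero_of_tgt (i ⊗ₘ j), zero_comp]
  have h₂ : (j ≫ s) ⊗ₘ (i ≫ r) = 0 := by
    rw [← tensorHom_comp_tensorHom, (hxy.of_iso (β_ y x)).eq_zero_of_tgt (j ⊗ₘ i), zero_comp]
  rw [mem_balancedEnd]
  change (i ≫ r) ▷ X = X ◁ (i ≫ r)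
  -- Once `𝟙 X` is expanded and the cross terms drop out, both sides equal `(i ≫ r) ⊗ (i ≫ r)`.
  rw [← tensorHom_id, ← id_tensorHom, ← h, MonoidalPreadditive.tensor_add,
    MonoidalPreadditive.add_tensor, h₁, h₂]

variable {Φ : TensorMultiplicativeSet C}

/-- A pair `(X, f)` represents zero if and only if `f ⊗ Y = 0` for some `Y ∈ Φ`. -/
lemma RingR.mk_eq_zero {x : BalancedPair Φ} (h : mk x = 0) :
    ∃ Y ∈ Φ.carrier, (x.hom : x.obj ⟶ x.obj) ▷ Y = 0 := by
  let N (x : BalancedPair Φ) : Prop := ∃ Y ∈ Φ.carrier, (x.hom : x.obj ⟶ x.obj) ▷ Y = 0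
  -- Invariance under the generating relation lets `N` descend to the quotient, where it can be
  -- tested on the representative of zero. Going back from the tensored pair, `a` is absorbed into
  -- the witness.
  have hN (x y : BalancedPair Φ) (h : BalancedPair.Rel x y) : N x = N y := by
    cases h with
    | left a ha =>
      refine propext ⟨fun ⟨Y, hY, h⟩ => ⟨Y, hY, ?_⟩, fun ⟨Y, hY, h⟩ =>
        ⟨Y ⊗ a, Φ.tensor_mem _ hY _ ha, ?_⟩⟩
      · change (a ◁ (x.hom : x.obj ⟶ x.obj)) ▷ Y = 0
        rw [whisker_assoc, h]
        simp
      · change (a ◁ (x.hom : x.obj ⟶ x.obj)) ▷ Y = 0 at h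
        refine whiskerRight_eq_zero_of_iso (β_ a Y) ?_
        have h2 : (x.hom : x.obj ⟶ x.obj) ▷ a ▷ Y = 0 := by
          rw [← cancel_mono ((β_ x.obj a).hom ▷ Y), ← comp_whiskerRight,
            BraidedCategory.braiding_naturality_left, comp_whiskerRight, h, comp_zero, zero_comp]
        rw [whiskerRight_tensor, h2, zero_comp, comp_zero]
    | right a ha =>
      refine propext ⟨fun ⟨Y, hY, h⟩ => ⟨Y, hY, ?_⟩, fun ⟨Y, hY, h⟩ =>
        ⟨a ⊗ Y, Φ.tensor_mem _ ha _ hY, ?_⟩⟩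
      · change (x.hom : x.obj ⟶ x.obj) ▷ a ▷ Y = 0
        have h2 : (x.hom : x.obj ⟶ x.obj) ▷ (a ⊗ Y) = 0 := by
          refine whiskerRight_eq_zero_of_iso (β_ Y a) ?_
          rw [whiskerRight_tensor, h]
          simp
        rw [whiskerRight_tensor] at h2
        simpa using h2
      · change (x.hom : x.obj ⟶ x.obj) ▷ a ▷ Y = 0 at h
        rw [whiskerRight_tensor, h, zero_comp, comp_zero]
  have h0 : Quot.lift N hN (0 : RingR Φ) :=
    ⟨_, Φ.nonempty.some_mem, by
      change (0 : Φ.nonempty.some ⟶ Φ.nonempty.some) ▷ _ = 0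
      simp⟩
  rw [← h] at h0
  exact h0

end Ring

/-- In a commutative ring with preconnected spectrum, the only idempotents are `0` and `1`. -/
lemma eq_zero_or_one_of_isIdempotentElem {R : Type*} [CommRing R]
    [PreconnectedSpace (PrimeSpectrum R)] {e : R} (he : IsIdempotentElem e) : e = 0 ∨ e = 1 := by
  have hclopen : IsClopen (PrimeSpectrum.basicOpen e : Set (PrimeSpectrum R)) :=
    PrimeSpectrum.isClopen_iff.2 ⟨e, he, rfl⟩
  rcases isClopen_iff.1 hclopen with h | h
  · exact .inl (PrimeSpectrum.basicOpen_injOn_isIdempotentElem he .zero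
      (SetLike.coe_injective (by simp [h])))
  · exact .inr (PrimeSpectrum.basicOpen_injOn_isIdempotentElem he .one
      (SetLike.coe_injective (by simp [h])))

/-! ### From separations of `Z_Φ` to idempotents of `R_Φ` -/

section Connected

variable {C : Type u} [Category.{v} C] [HasZeroObject C] [HasShift C ℤ] [Preadditive C]
  [∀ n : ℤ, (shiftFunctor C n).Additive] [Pretriangulated C]
  [MonoidalCategory C] [MonoidalPreadditive C] [SymmetricCategory C]

/-- If `f` represents zero in `R_Φ` and `1 - f` factors through an object of a thick tensor ideal,
then this ideal meets `Φ`. -/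
lemma exists_mem_of_mk_eq_zero {Φ : TensorMultiplicativeSet C} {P : ObjectProperty C}
    (hP : IsThickTensorIdeal P) {X x : C} (hX : X ∈ Φ.carrier) {f : X ⟶ X} {hf : f ∈ balancedEnd X}
    (h0 : RingR.of Φ X hX ⟨f, hf⟩ = 0) (hx : P x) (i : X ⟶ x) (r : x ⟶ X)
    (h : f + i ≫ r = 𝟙 X) : ∃ Y ∈ Φ.carrier, P Y := by
  obtain ⟨Y, hY, hfY⟩ := RingR.mk_eq_zero h0
  change f ▷ Y = 0 at hfY
  -- Since `f ⊗ Y = 0`, the map `(i ≫ r) ⊗ Y` is the identity, so `X ⊗ Y` is a retract of `x ⊗ Y`.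
  refine ⟨X ⊗ Y, Φ.tensor_mem _ hX _ hY, hP.retract_mem ⟨i ▷ Y, r ▷ Y, ?_⟩
    (hP.iso_mem (β_ Y x) (hP.tensor_mem Y hx))⟩
  rw [← comp_whiskerRight, ← zero_add ((i ≫ r) ▷ Y), ← hfY,
    ← MonoidalPreadditive.add_whiskerRight, h, id_whiskerRight]

variable [(curriedTensor C).CommShift₂Int] [TensorTriangulated C]

/-- In a rigid tensor triangulated category, `Z_Φ` is preconnected when the spectrum of `R_Φ` is:
a separation of `Z_Φ` gives a non-trivial idempotent. -/
theorem isPreconnected_suppSet [RightRigidCategory C] (Φ : TensorMultiplicativeSet C)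
    [PreconnectedSpace (PrimeSpectrum (RingR Φ))] : _root_.IsPreconnected (suppSet Φ) := by
  rw [isPreconnected_iff_subset_of_fully_disjoint_closed (isClosed_suppSet Φ)]
  intro u v hu hv huv hdisj
  obtain ⟨a, b, hua, hvb, hab⟩ := exists_isZero_tensor_of_disjoint hu hv hdisj
  let Q : ObjectProperty C := annihilator (· = a)
  let P : ObjectProperty C := annihilator Q
  have hQ : IsThickTensorIdeal Q := isThickTensorIdeal_annihilator _
  have hP : IsThickTensorIdeal P := isThickTensorIdeal_annihilator _
  have hbQ : Q b := by
    rintro _ rfl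
    exact hab.of_iso (β_ _ _)
  have haP : P a := fun y hy => (hy a rfl).of_iso (β_ a y)
  have hPQ (x y : C) (hx : P x) (hy : Q y) (f : x ⟶ y) : f = 0 :=
    hom_eq_zero_of_isZero_tensor ((hx y hy).of_iso (β_ y x)) f
  have hQP (x y : C) (hx : P x) (hy : Q y) (f : y ⟶ x) : f = 0 :=
    hom_eq_zero_of_isZero_tensor (hx y hy) f
  -- Otherwise some prime in `Z_Φ` would contain both `a` and `b`, yet a prime in `u` omits `a` and
  -- one in `v` omits `b`.
  obtain ⟨X, hX, x, y, hx, hy, i, r, j, s, h⟩ : ∃ X ∈ Φ.carrier, retractSum P Q X := by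
    by_contra! hne
    obtain ⟨p, hp, hle⟩ := exists_le_prime_of_disjoint
      (isThickTensorIdeal_retractSum hP hQ hPQ hQP) Φ hne
    rcases huv hp with hpu | hpv
    · exact hua hpu (hle _ ⟨a, b, haP, hbQ, 𝟙 a, 𝟙 a, 0, 0, by simp⟩)
    · exact hvb hpv (hle _ ⟨a, b, haP, hbQ, 0, 0, 𝟙 b, 𝟙 b, by simp⟩)
  have hyx : IsZero (y ⊗ x) := (hx y hy).of_iso (β_ y x)
  let e : balancedEnd X := ⟨i ≫ r, mem_balancedEnd_of_isZero_tensor (hx y hy) h⟩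
  let e' : balancedEnd X :=
    ⟨j ≫ s, mem_balancedEnd_of_isZero_tensor hyx ((add_comm _ _).trans h)⟩
  have hsum : e + e' = 1 := Subtype.ext h
  have hmul : e * e' = 0 := by
    refine Subtype.ext ?_
    change (j ≫ s) ≫ i ≫ r = 0
    rw [Category.assoc, ← Category.assoc s, hQP x y hx hy (s ≫ i)]
    simp
  have hid : IsIdempotentElem (RingR.of Φ X hX e) := by
    rw [IsIdempotentElem, ← RingR.of_mul]
    congr 1
    calc e * e = e * (e + e') := by rw [mul_add, hmul, add_zero]
      _ = e := by rw [hsum, mul_one]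
  rcases eq_zero_or_one_of_isIdempotentElem hid with h0 | h1
  -- Here `Y ∈ Φ` lies in `Q`, so `Y ⊗ a = 0`, and no point of `Z_Φ` lies in `supp a ⊇ u`.
  · obtain ⟨Y, hY, hYQ⟩ := exists_mem_of_mk_eq_zero hQ hX h0 hy j s h
    refine .inr fun p hp => (huv hp).resolve_left fun hpu => ?_
    have : p ∈ supp (Y ⊗ a) := supp_tensor Y a ▸ ⟨mem_suppSet.1 hp Y hY, hua hpu⟩
    rwa [supp_eq_empty_of_isZero (hYQ a rfl)] at this
  · have h0 : RingR.of Φ X hX e' = 0 := by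
      have := RingR.of_add (Φ := Φ) X hX e e'
      rw [hsum, RingR.of_one, h1] at this
      exact left_eq_add.1 this
    obtain ⟨Y, hY, hYP⟩ := exists_mem_of_mk_eq_zero hP hX h0 hx i r ((add_comm _ _).trans h)
    refine .inl fun p hp => (huv hp).resolve_right fun hpv => ?_
    have : p ∈ supp (Y ⊗ b) := supp_tensor Y b ▸ ⟨mem_suppSet.1 hp Y hY, hvb hpv⟩
    rwa [supp_eq_empty_of_isZero (hYP b hbQ)] at this

/-- `Z_Φ` is non-empty when `R_Φ` is non-trivial. -/
theorem suppSet_nonempty (Φ : TensorMultiplicativeSet C) [Nontrivial (RingR Φ)] :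
    (suppSet Φ).Nonempty := by
  -- A zero object in `Φ` would force `0 = 1` in its endomorphism ring, hence in `R_Φ`; so the zero
  -- ideal misses `Φ`.
  obtain ⟨P, hP, -⟩ := exists_le_prime_of_disjoint isThickTensorIdeal_isZero Φ (fun X hX h0 =>
    zero_ne_one (α := RingR Φ) (by
      rw [← RingR.of_zero X hX, ← RingR.of_one X hX]
      exact congrArg _ (Subtype.ext (h0.eq_of_src _ _))))
  exact ⟨P, hP⟩

end Connected

end TTGeom

theorem mainTheorem8 {C : Type u} [CategoryTheory.Category.{v} C]
    [HasZeroObject C] [HasShift C ℤ] [Preadditive C]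
    [∀ n : ℤ, (shiftFunctor C n).Additive] [Pretriangulated C]
    [CategoryTheory.IsTriangulated C]
    [MonoidalCategory C] [MonoidalPreadditive C] [SymmetricCategory C]
    [(curriedTensor C).CommShift₂Int] [TTGeom.TensorTriangulated C]
    (hrigid : TTGeom.IsRigid C)
    (Φ : TTGeom.TensorMultiplicativeSet C)
    (hΦ : TTGeom.IsThomason (TTGeom.suppSet Φ)) :
    (PreconnectedSpace (PrimeSpectrum (TTGeom.RingR Φ)) → _root_.IsPreconnected (TTGeom.suppSet Φ)) ∧
    (ConnectedSpace (PrimeSpectrum (TTGeom.RingR Φ)) → _root_.IsConnected (TTGeom.suppSet Φ)) := by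
  obtain ⟨_, -⟩ := hrigid
  refine ⟨fun _ => TTGeom.isPreconnected_suppSet Φ, fun _ =>
    ⟨?_, TTGeom.isPreconnected_suppSet Φ⟩⟩
  have : Nontrivial (TTGeom.RingR Φ) := PrimeSpectrum.nonempty_iff_nontrivial.1 inferInstance
  exact TTGeom.suppSet_nonempty Φ
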